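/- Let $H_p=\sum_{k=1}^{p}1/k$ denote the harmonic numbers and let $\zeta'$ denote the derivative of the (analytically continued) Riemann zeta function. For every integer $n\ge 0$ the following integral converges absolutely and \[ 2\,(-1)^n\int_0^\infty \frac{x^{2n}\arctan x}{e^{2\pi x}-1}\,dx=\frac{H_{2n+1}}{2n+1}+\sum_{k=0}^{2n}(-1)^k\binom{2n}{k}\,\zeta'(-k), \] and for every integer $n\ge 1$ the following integral converges absolutely and \[ (-1)^n\int_0^\infty \frac{x^{2n-1}\log(1+x^2)}{e^{2\pi x}-1}\,dx=\frac{H_{2n}}{2n}+\sum_{k=0}^{2n-1}(-1)^k\binom{2n-1}{k}\,\zeta'(-k). \] -/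

import Mathlib

open MeasureTheory

/-! Everything follows from Hermite's formula `riemannZeta_eq_integral`: away from s = 1, ζ(s) - 1/2
- 1/(s - 1) is the integral of -i((1 - ix)^(-s) - (1 + ix)^(-s)) against the Bose weight. For Re s >
1 it comes from the Mellin transform of 1/(e^t - 1), with Legendre's integral
`integral_sin_mul_boseWeight` inserted and the order of integration exchanged; the identity theorem
extends it.

Differentiating at s = -k gives -1/(k + 1)^2 plus an integral of (1 ∓ ix)^k log(1 ∓ ix). In the sum
over k with weights (-1)^k C(n, k), the binomial theorem collapses the powers to (±ix)^n
(`sum_choose_mul_hermiteKernelDeriv`), and the rational terms give -H_{n+1}/(n + 1)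
(`sum_neg_one_pow_mul_choose_div_sq`). Since log(1 ± ix) = log(1 + x^2)/2 ± i arctan x, even n keeps
only the arctangent and odd n only the logarithm. -/

/-- The Bose weight `1 / (e ^ (2πx) - 1)` of Hermite's and Binet's formulas. -/
noncomputable def boseWeight (x : ℝ) : ℝ := (Real.exp (2 * Real.pi * x) - 1)⁻¹

lemma boseWeight_pos {x : ℝ} (hx : 0 < x) : 0 < boseWeight x := by
  have : 1 < Real.exp (2 * Real.pi * x) := Real.one_lt_exp_iff.2 (by positivity)
  exact inv_pos.2 (by linarith)

@[fun_prop]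
lemma measurable_boseWeight : Measurable boseWeight := by
  unfold boseWeight; fun_prop

/-- The factor x cancels the simple pole of the weight at 0. The bound amounts to x ≤ e^(πx) -
e^(-πx), which follows from e^(πx) ≥ 1 + πx. -/
lemma mul_boseWeight_le {x : ℝ} (hx : 0 < x) :
    x * boseWeight x ≤ Real.exp (-(Real.pi * x)) := by
  have h1 : 1 < Real.exp (2 * Real.pi * x) := Real.one_lt_exp_iff.2 (by positivity)
  rw [boseWeight, ← div_eq_mul_inv, div_le_iff₀ (by linarith), mul_sub, ← Real.exp_add, mul_one,
    show -(Real.pi * x) + 2 * Real.pi * x = Real.pi * x by ring]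
  have h2 := Real.add_one_le_exp (Real.pi * x)
  have h3 : Real.exp (-(Real.pi * x)) ≤ 1 := Real.exp_le_one_iff.2 (by
    have := Real.pi_pos; nlinarith)
  nlinarith [Real.pi_gt_three]

lemma integrableOn_pow_mul_boseWeight (M : ℕ) :
    IntegrableOn (fun x : ℝ => (1 + x) ^ M * (x * boseWeight x)) (Set.Ioi 0) := by
  have h : IntegrableOn (fun x : ℝ => (M.factorial * Real.exp 1) * Real.exp (-1 * x))
      (Set.Ioi 0) := (integrableOn_exp_mul_Ioi (by norm_num) 0).const_mul _
  refine Integrable.mono' h (by fun_prop) ?_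
  filter_upwards [ae_restrict_mem measurableSet_Ioi] with x hx
  have hx : 0 < x := hx
  have hb := boseWeight_pos hx
  rw [Real.norm_of_nonneg (by positivity)]
  have h1 : (1 + x) ^ M ≤ Real.exp (1 + x) * M.factorial :=
    (div_le_iff₀ (by positivity)).1 (Real.pow_div_factorial_le_exp _ (by positivity) M)
  calc (1 + x) ^ M * (x * boseWeight x)
      ≤ (Real.exp (1 + x) * M.factorial) * Real.exp (-(Real.pi * x)) := by
        gcongr; exact mul_boseWeight_le hx
    _ = (M.factorial * Real.exp 1) * Real.exp (x - Real.pi * x) := by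
        rw [sub_eq_add_neg, Real.exp_add, Real.exp_add]; ring
    _ ≤ _ := by
        gcongr; nlinarith [Real.pi_gt_three]

lemma integrableOn_mul_boseWeight :
    IntegrableOn (fun x : ℝ => x * boseWeight x) (Set.Ioi 0) := by
  simpa using integrableOn_pow_mul_boseWeight 0

/-! ### Legendre's integral -/

lemma hasSum_boseWeight {x : ℝ} (hx : 0 < x) :
    HasSum (fun n : ℕ => Real.exp (-(2 * Real.pi * (n + 1)) * x)) (boseWeight x) := by
  have h1 : Real.exp (-(2 * Real.pi * x)) < 1 := Real.exp_lt_one_iff.2 (neg_lt_zero.2 (by positivity))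
  have h := (hasSum_geometric_of_lt_one (Real.exp_pos _).le h1).mul_left
    (Real.exp (-(2 * Real.pi * x)))
  convert! h using 1
  · ext n
    rw [← Real.exp_nat_mul, ← Real.exp_add]; ring_nf
  · have : Real.exp (2 * Real.pi * x) - 1 ≠ 0 := by
      have : 1 < Real.exp (2 * Real.pi * x) := Real.one_lt_exp_iff.2 (by positivity)
      linarith
    have h3 : 1 - Real.exp (-(2 * Real.pi * x)) ≠ 0 := by linarith
    rw [boseWeight, Real.exp_neg] at *
    field_simp at *

lemma integrableOn_sin_mul_exp {a : ℝ} (ha : 0 < a) (t : ℝ) :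
    IntegrableOn (fun x : ℝ => Real.sin (x * t) * Real.exp (-a * x)) (Set.Ioi 0) := by
  refine Integrable.mono' (integrableOn_exp_mul_Ioi (neg_lt_zero.2 ha) 0) (by fun_prop) ?_
  filter_upwards with x
  rw [norm_mul, Real.norm_of_nonneg (Real.exp_pos _).le]
  exact mul_le_of_le_one_left (Real.exp_pos _).le (Real.abs_sin_le_one _)

lemma integral_sin_mul_exp {a : ℝ} (ha : 0 < a) (t : ℝ) :
    ∫ x in Set.Ioi (0 : ℝ), Real.sin (x * t) * Real.exp (-a * x) = t / (a ^ 2 + t ^ 2) := by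
  have hre : (-(a : ℂ) + t * Complex.I).re < 0 := by simpa
  have h1 := integral_exp_mul_complex_Ioi hre 0
  have h2 := integrableOn_exp_mul_complex_Ioi hre 0
  have h3 := congrArg Complex.im h1
  rw [← RCLike.im_to_complex, ← integral_im h2] at h3
  convert! h3 using 1
  · refine integral_congr_ae (Filter.Eventually.of_forall fun x => ?_)
    simp [Complex.exp_im, mul_comm]
  · have : a ^ 2 + t ^ 2 ≠ 0 := by positivity
    simp [Complex.div_im, Complex.normSq_apply]
    field_simp

/-- Using |sin u| ≤ |u| rather than |sin u| ≤ 1 yields a^(-2) instead of a^(-1), hence summability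
over a = 2π(n + 1) and the termwise integration in Legendre's integral. -/
lemma integral_abs_sin_mul_exp_le {a : ℝ} (ha : 0 < a) {t : ℝ} (ht : 0 ≤ t) :
    ∫ x in Set.Ioi (0 : ℝ), ‖Real.sin (x * t) * Real.exp (-a * x)‖ ≤ t / a ^ 2 := by
  have hi : IntegrableOn (fun x : ℝ => x * Real.exp (-a * x)) (Set.Ioi 0) := by
    simpa using integrableOn_rpow_mul_exp_neg_mul_rpow (p := 1) (s := 1) (b := a)
      (by norm_num) one_pos ha
  have hv : ∫ x in Set.Ioi (0 : ℝ), x * Real.exp (-a * x) = 1 / a ^ 2 := by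
    have := Real.integral_rpow_mul_exp_neg_mul_Ioi (a := 2) two_pos ha
    norm_num at this
    simpa using this
  calc _ ≤ ∫ x in Set.Ioi (0 : ℝ), t * (x * Real.exp (-a * x)) := by
        refine setIntegral_mono_on (integrableOn_sin_mul_exp ha t).norm (hi.const_mul t)
          measurableSet_Ioi fun x hx => ?_
        have hx : 0 < x := hx
        rw [norm_mul, Real.norm_of_nonneg (Real.exp_pos _).le, ← mul_assoc, mul_comm t]
        gcongr
        exact Real.abs_sin_le_abs.trans (abs_of_nonneg (by positivity)).le
    _ = t / a ^ 2 := by rw [integral_const_mul, hv]; ring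

lemma summable_div_two_pi_mul_sq (t : ℝ) :
    Summable fun n : ℕ => t / (2 * Real.pi * (n + 1)) ^ 2 := by
  have h := (summable_nat_add_iff 1).2 (Real.summable_one_div_nat_pow.2 one_lt_two)
  refine (h.mul_left (t / (2 * Real.pi) ^ 2)).congr fun n => ?_
  push_cast
  field_simp

/-- This is the partial fraction expansion of π cot(πz) at z = it/(2π). -/
lemma tsum_div_two_pi_mul_sq_add_sq {t : ℝ} (ht : 0 < t) :
    2 * ∑' n : ℕ, t / ((2 * Real.pi * (n + 1)) ^ 2 + t ^ 2) =
      1 / 2 + 1 / (Real.exp t - 1) - 1 / t := by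
  have hπ : (Real.pi : ℂ) ≠ 0 := by simp
  have htc : (t : ℂ) ≠ 0 := by simpa using ht.ne'
  have hz : (t / (2 * Real.pi) * Complex.I : ℂ) ∈ Complex.integerComplement := by
    rintro ⟨n, hn⟩
    have := congrArg Complex.im hn
    rw [show (t / (2 * Real.pi) : ℂ) = ((t / (2 * Real.pi) : ℝ) : ℂ) by push_cast; rfl,
      Complex.mul_I_im, Complex.ofReal_re, Complex.intCast_im] at this
    have : 0 < t / (2 * Real.pi) := by positivity
    linarith
  have h := cot_series_rep' hz
  have hterm : ∀ n : ℕ, (1 / ((t / (2 * Real.pi) * Complex.I : ℂ) - (n + 1)) +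
      1 / ((t / (2 * Real.pi) * Complex.I : ℂ) + (n + 1))) =
      (-(4 * Real.pi) * Complex.I) * ((t / ((2 * Real.pi * (n + 1)) ^ 2 + t ^ 2) : ℝ) : ℂ) := by
    intro n
    have hn : ((n : ℂ) + 1) ≠ 0 := by exact_mod_cast n.succ_ne_zero
    have h1 : (t / (2 * Real.pi) * Complex.I : ℂ) - (n + 1) ≠ 0 := by
      simpa [sub_eq_add_neg, add_comm] using
        Complex.integerComplement_add_ne_zero hz (-(n + 1) : ℤ)
    have h2 : (t / (2 * Real.pi) * Complex.I : ℂ) + (n + 1) ≠ 0 := by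
      simpa using Complex.integerComplement_add_ne_zero hz ((n : ℤ) + 1)
    have h3 : ((2 * Real.pi * (n + 1)) ^ 2 + t ^ 2 : ℂ) ≠ 0 := by
      norm_cast; positivity
    rw [one_div_add_one_div h1 h2]
    push_cast
    have h4 : ((t / (2 * Real.pi) * Complex.I : ℂ) - (n + 1)) *
        ((t / (2 * Real.pi) * Complex.I : ℂ) + (n + 1)) =
        -((2 * Real.pi * (n + 1)) ^ 2 + t ^ 2) / (2 * Real.pi) ^ 2 := by
      field_simp
      ring_nf
      simp only [Complex.I_sq]
      ring
    rw [h4]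
    field_simp
    ring
  simp_rw [hterm] at h
  rw [tsum_mul_left, ← Complex.ofReal_tsum, Complex.cot_pi_eq_exp_ratio,
    show (2 * Real.pi * Complex.I * (t / (2 * Real.pi) * Complex.I) : ℂ) = ((-t : ℝ) : ℂ) by
      field_simp; simp, ← Complex.ofReal_exp] at h
  have he : Real.exp t - 1 ≠ 0 := by
    have := Real.add_one_lt_exp ht.ne'; linarith
  have he' : (Real.exp t - 1 : ℂ) ≠ 0 := by exact_mod_cast he
  have hne : (Real.exp t : ℂ) ≠ 0 := by exact_mod_cast (Real.exp_pos t).ne'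
  set S := ∑' n : ℕ, t / ((2 * Real.pi * (n + 1)) ^ 2 + t ^ 2)
  rw [Real.exp_neg] at h
  apply Complex.ofReal_injective
  push_cast at h ⊢
  rw [← Complex.ofReal_exp] at h ⊢
  have h5 : (1 - (Real.exp t : ℂ)⁻¹) = (Real.exp t - 1) / Real.exp t := by field_simp
  rw [h5] at h
  have h6 : (2 : ℂ) * S = (Complex.I / (2 * Real.pi)) * (-(4 * Real.pi) * Complex.I * S) := by
    field_simp
    simp
    ring
  rw [h6, ← h]
  field_simp
  simp
  ring

/-- Legendre's integral. -/
lemma integral_sin_mul_boseWeight {t : ℝ} (ht : 0 < t) :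
    2 * ∫ x in Set.Ioi (0 : ℝ), Real.sin (x * t) * boseWeight x =
      1 / 2 + 1 / (Real.exp t - 1) - 1 / t := by
  have ha (n : ℕ) : 0 < 2 * Real.pi * ((n : ℝ) + 1) := by positivity
  have hs : Summable fun n : ℕ => ∫ x in Set.Ioi (0 : ℝ),
      ‖Real.sin (x * t) * Real.exp (-(2 * Real.pi * (n + 1)) * x)‖ :=
    (summable_div_two_pi_mul_sq t).of_nonneg_of_le
      (fun n => integral_nonneg fun _ => norm_nonneg _)
      fun n => integral_abs_sin_mul_exp_le (ha n) ht.le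
  have h := integral_tsum_of_summable_integral_norm
    (fun n : ℕ => integrableOn_sin_mul_exp (ha n) t) hs
  simp_rw [fun n : ℕ => integral_sin_mul_exp (ha n) t] at h
  rw [← tsum_div_two_pi_mul_sq_add_sq ht, h]
  congr 1
  refine setIntegral_congr_fun measurableSet_Ioi fun x hx => ?_
  exact (((hasSum_boseWeight hx).mul_left _).tsum_eq).symm

/-! ### Gamma integrals with complex scale -/

lemma norm_ofReal_cpow_sub_one {t : ℝ} (ht : 0 < t) (s : ℂ) :
    ‖(t : ℂ) ^ (s - 1)‖ = t ^ (s.re - 1) := by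
  simp [Complex.norm_cpow_eq_rpow_re_of_pos ht]

@[fun_prop]
lemma measurable_ofReal_cpow (s : ℂ) : Measurable fun t : ℝ => (t : ℂ) ^ s :=
  Complex.measurable_ofReal.pow_const s

lemma integrableOn_rpow_mul_exp {σ b : ℝ} (hσ : -1 < σ) (hb : 0 < b) :
    IntegrableOn (fun t : ℝ => t ^ σ * Real.exp (-b * t)) (Set.Ioi 0) := by
  simpa using integrableOn_rpow_mul_exp_neg_mul_rpow (p := 1) (s := σ) (b := b) hσ one_pos hb

lemma integrableOn_cpow_mul_cexp {s r : ℂ} (hs : 0 < s.re) (hr : 0 < r.re) :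
    IntegrableOn (fun t : ℝ => (t : ℂ) ^ (s - 1) * Complex.exp (-(r * t))) (Set.Ioi 0) := by
  refine Integrable.mono' (integrableOn_rpow_mul_exp (σ := s.re - 1) (by linarith) hr)
    (by fun_prop) ?_
  filter_upwards [ae_restrict_mem measurableSet_Ioi] with t ht
  rw [norm_mul, norm_ofReal_cpow_sub_one ht, Complex.norm_exp]
  simp

lemma differentiableAt_integral_cpow_mul_cexp {s r : ℂ} (hs : 0 < s.re) (hr : 0 < r.re) :
    DifferentiableAt ℂ
      (fun r : ℂ => ∫ t in Set.Ioi (0 : ℝ), (t : ℂ) ^ (s - 1) * Complex.exp (-(r * t))) r := by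
  refine (hasDerivAt_integral_of_dominated_loc_of_deriv_le (𝕜 := ℂ)
    (μ := volume.restrict (Set.Ioi 0))
    (F := fun r t => (t : ℂ) ^ (s - 1) * Complex.exp (-(r * t)))
    (F' := fun r t => (t : ℂ) ^ (s - 1) * (Complex.exp (-(r * t)) * (-t)))
    (bound := fun t => t ^ s.re * Real.exp (-(r.re / 2) * t))
    (Metric.ball_mem_nhds r (half_pos hr)) ?_ (integrableOn_cpow_mul_cexp hs hr)
    (by fun_prop) ?_ (integrableOn_rpow_mul_exp (by linarith) (half_pos hr)) ?_).2.differentiableAt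
  · exact Filter.Eventually.of_forall fun r => by fun_prop
  · filter_upwards [ae_restrict_mem measurableSet_Ioi] with t ht w hw
    have ht : 0 < t := ht
    have h1 : r.re / 2 ≤ w.re := by
      have h2 := (Complex.abs_re_le_norm (w - r)).trans (mem_ball_iff_norm.1 hw).le
      rw [Complex.sub_re] at h2
      linarith [(abs_le.1 h2).1]
    rw [norm_mul, norm_mul, norm_ofReal_cpow_sub_one ht, Complex.norm_exp, norm_neg,
      Complex.norm_of_nonneg ht.le, Real.rpow_sub_one ht.ne']
    calc _ = t ^ s.re * Real.exp (-w.re * t) := by simp; field_simp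
      _ ≤ _ := by gcongr
  · refine Filter.Eventually.of_forall fun t w _ => ?_
    have h : HasDerivAt (fun w : ℂ => -(w * t)) (-t) w := by
      simpa using! ((hasDerivAt_id w).mul_const (t : ℂ)).neg
    exact h.cexp.const_mul _

/-- The Gamma integral with a complex scale in the right half-plane. -/
lemma integral_cpow_mul_cexp {s r : ℂ} (hs : 0 < s.re) (hr : 0 < r.re) :
    ∫ t in Set.Ioi (0 : ℝ), (t : ℂ) ^ (s - 1) * Complex.exp (-(r * t)) =
      r ^ (-s) * Complex.Gamma s := by
  have hU : IsOpen {r : ℂ | 0 < r.re} := isOpen_lt continuous_const Complex.continuous_re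
  have hf : AnalyticOnNhd ℂ (fun r : ℂ => ∫ t in Set.Ioi (0 : ℝ),
      (t : ℂ) ^ (s - 1) * Complex.exp (-(r * t))) {r : ℂ | 0 < r.re} :=
    DifferentiableOn.analyticOnNhd (fun r hr =>
      (differentiableAt_integral_cpow_mul_cexp hs hr).differentiableWithinAt) hU
  have hg : AnalyticOnNhd ℂ (fun r : ℂ => r ^ (-s) * Complex.Gamma s) {r : ℂ | 0 < r.re} :=
    DifferentiableOn.analyticOnNhd (fun r hr =>
      ((differentiableAt_id.cpow_const (Or.inl hr)).mul_const _).differentiableWithinAt) hU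
  -- Real scales are the classical case; they accumulate at 1, which suffices for the identity
  -- theorem on the right half-plane.
  have hreal : ∀ᶠ u : ℝ in nhdsWithin 1 {1}ᶜ,
      (∫ t in Set.Ioi (0 : ℝ), (t : ℂ) ^ (s - 1) * Complex.exp (-((u : ℂ) * t))) =
        (u : ℂ) ^ (-s) * Complex.Gamma s := by
    filter_upwards [mem_nhdsWithin_of_mem_nhds (Ioi_mem_nhds one_pos)] with u hu
    have hu : 0 < u := hu
    rw [Complex.integral_cpow_mul_exp_neg_mul_Ioi hs hu, one_div,
      Complex.inv_cpow _ _ (by rw [Complex.arg_ofReal_of_nonneg hu.le]; exact Real.pi_ne_zero.symm),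
      Complex.cpow_neg]
  have ht : Filter.Tendsto (fun u : ℝ => (u : ℂ)) (nhdsWithin 1 {1}ᶜ) (nhdsWithin 1 {1}ᶜ) := by
    refine tendsto_nhdsWithin_iff.2 ⟨?_, ?_⟩
    · exact (Complex.continuous_ofReal.tendsto' 1 1 (by simp)).mono_left nhdsWithin_le_nhds
    · filter_upwards [self_mem_nhdsWithin] with u hu
      simpa using hu
  exact hf.eqOn_of_preconnected_of_frequently_eq hg (convex_halfSpace_re_gt 0).isPreconnected
    (by simp : (1 : ℂ) ∈ {r : ℂ | 0 < r.re}) (ht.frequently hreal.frequently) hr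

/-! ### Hermite's formula for Re s > 1 -/

lemma hasSum_one_div_exp_sub_one {t : ℝ} (ht : 0 < t) :
    HasSum (fun n : ℕ => Real.exp (-((n : ℝ) + 1) * t)) (1 / (Real.exp t - 1)) := by
  have h := hasSum_boseWeight (x := t / (2 * Real.pi)) (by positivity)
  rw [boseWeight, ← one_div, mul_div_cancel₀ _ (by positivity)] at h
  convert! h using 3
  field_simp

lemma mellin_one_div_exp_sub_one {s : ℂ} (hs : 1 < s.re) :
    mellin (fun t : ℝ => ((1 / (Real.exp t - 1) : ℝ) : ℂ)) s =
      Complex.Gamma s * riemannZeta s := by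
  have h := hasSum_mellin (a := fun _ : ℕ => 1) (p := fun n : ℕ => (n : ℝ) + 1)
    (F := fun t : ℝ => ((1 / (Real.exp t - 1) : ℝ) : ℂ)) (s := s)
    (fun n => Or.inr (by positivity)) (by linarith)
    (fun t ht => by
      simpa using Complex.hasSum_ofReal.2 (hasSum_one_div_exp_sub_one ht)) (by
      have := (summable_nat_add_iff 1).2 (Real.summable_one_div_nat_rpow.2 hs)
      simpa using this)
  rw [← h.tsum_eq, zeta_eq_tsum_one_div_nat_add_one_cpow hs, ← tsum_mul_left]
  refine tsum_congr fun n => ?_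
  push_cast
  ring

/-- The integrand of Hermite's formula for the Riemann zeta function. -/
noncomputable def hermiteKernel (s : ℂ) (x : ℝ) : ℂ :=
  -Complex.I * ((1 - x * Complex.I) ^ (-s) - (1 + x * Complex.I) ^ (-s)) * boseWeight x

/-- Writing the sine by exponentials turns e^(-t) into e^(-(1 ∓ ix)t), leaving two Gamma integrals
of scale 1 ∓ ix. -/
lemma integral_cpow_mul_sin {s : ℂ} (hs : 0 < s.re) (x : ℝ) :
    ∫ t in Set.Ioi (0 : ℝ), (t : ℂ) ^ (s - 1) * Complex.exp (-t) *
      ((2 * (Real.sin (x * t) * boseWeight x) : ℝ) : ℂ) =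
      Complex.Gamma s * hermiteKernel s x := by
  have hm : 0 < (1 - x * Complex.I : ℂ).re := by simp
  have hp : 0 < (1 + x * Complex.I : ℂ).re := by simp
  have h : ∀ t : ℝ, (t : ℂ) ^ (s - 1) * Complex.exp (-t) *
      ((2 * (Real.sin (x * t) * boseWeight x) : ℝ) : ℂ) =
      (-Complex.I * boseWeight x) *
        ((t : ℂ) ^ (s - 1) * Complex.exp (-((1 - x * Complex.I) * t)) -
          (t : ℂ) ^ (s - 1) * Complex.exp (-((1 + x * Complex.I) * t))) := fun t => by
    rw [show -((1 - x * Complex.I) * t) = -(t : ℂ) + x * t * Complex.I by ring,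
      show -((1 + x * Complex.I) * t) = -(t : ℂ) + -(x * t) * Complex.I by ring,
      Complex.exp_add, Complex.exp_add]
    push_cast
    rw [Complex.sin]
    ring
  simp_rw [h]
  rw [integral_const_mul, integral_sub (integrableOn_cpow_mul_cexp hs hm)
    (integrableOn_cpow_mul_cexp hs hp), integral_cpow_mul_cexp hs hm,
    integral_cpow_mul_cexp hs hp, hermiteKernel]
  ring

lemma integrable_cpow_mul_sin_prod {s : ℂ} (hs : 0 < s.re) :
    Integrable (Function.uncurry fun (t x : ℝ) => (t : ℂ) ^ (s - 1) * Complex.exp (-t) *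
      ((2 * (Real.sin (x * t) * boseWeight x) : ℝ) : ℂ))
      ((volume.restrict (Set.Ioi 0)).prod (volume.restrict (Set.Ioi 0))) := by
  have hb := Integrable.mul_prod
    ((integrableOn_rpow_mul_exp (σ := s.re) (b := 1) (by linarith) one_pos).const_mul 2)
    integrableOn_mul_boseWeight
  refine Integrable.mono' hb ?_ ?_
  · have hm : Measurable fun p : ℝ × ℝ => (p.1 : ℂ) ^ (s - 1) :=
      (measurable_ofReal_cpow (s - 1)).comp measurable_fst
    have hw : Measurable fun p : ℝ × ℝ => boseWeight p.2 :=
      measurable_boseWeight.comp measurable_snd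
    unfold Function.uncurry
    exact Measurable.aestronglyMeasurable (by fun_prop)
  · rw [Measure.prod_restrict]
    filter_upwards [ae_restrict_mem (measurableSet_Ioi.prod measurableSet_Ioi)] with p hp
    obtain ⟨t, x⟩ := p
    obtain ⟨ht, hx⟩ : 0 < t ∧ 0 < x := hp
    have hw := boseWeight_pos hx
    simp only [Function.uncurry]
    rw [norm_mul, norm_mul, norm_ofReal_cpow_sub_one ht, Complex.norm_exp, Complex.norm_real,
      norm_mul, norm_mul, Real.norm_of_nonneg hw.le, Real.rpow_sub_one ht.ne']
    have h1 : ‖Real.sin (x * t)‖ ≤ x * t :=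
      Real.abs_sin_le_abs.trans (abs_of_nonneg (by positivity)).le
    calc _ ≤ t ^ s.re / t * Real.exp (-1 * t) * (2 * ((x * t) * boseWeight x)) := by
          simp only [Complex.neg_re, Complex.ofReal_re, neg_mul, one_mul, Real.norm_ofNat]
          gcongr
      _ = _ := by field_simp

/-- Hermite's formula on the half-plane of convergence. -/
lemma riemannZeta_eq_integral_of_one_lt_re {s : ℂ} (hs : 1 < s.re) :
    riemannZeta s = 1 / 2 + 1 / (s - 1) + ∫ x in Set.Ioi (0 : ℝ), hermiteKernel s x := by
  have hs0 : 0 < s.re := by linarith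
  have hs1 : 0 < (s - 1).re := by simpa
  have hne : s - 1 ≠ 0 := fun h => by simp [h] at hs1
  have hΓ : Complex.Gamma s ≠ 0 := Complex.Gamma_ne_zero_of_re_pos hs0
  have hone : (0 : ℝ) < (1 : ℂ).re := by simp
  have hI := integrable_cpow_mul_sin_prod hs0
  have hswap := integral_integral_swap hI
  simp_rw [integral_cpow_mul_sin hs0] at hswap
  have hIt := hI.integral_prod_left
  simp only [Function.uncurry] at hIt
  -- Here 1/(e^t - 1) = e^(-t)(1 + 1/(e^t - 1)), and Legendre's integral rewrites the bracket as 1/2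
  -- + 1/t plus the sine integral.
  have hsplit : mellin (fun t : ℝ => ((1 / (Real.exp t - 1) : ℝ) : ℂ)) s =
      ∫ t in Set.Ioi (0 : ℝ), ((1 / 2 * ((t : ℂ) ^ (s - 1) * Complex.exp (-(1 * t))) +
        (t : ℂ) ^ (s - 1 - 1) * Complex.exp (-(1 * t))) +
        ∫ x in Set.Ioi (0 : ℝ), (t : ℂ) ^ (s - 1) * Complex.exp (-t) *
          ((2 * (Real.sin (x * t) * boseWeight x) : ℝ) : ℂ)) := by
    refine setIntegral_congr_fun measurableSet_Ioi fun t ht => ?_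
    have ht : 0 < t := ht
    have htc : (t : ℂ) ≠ 0 := by exact_mod_cast ht.ne'
    have he : (Complex.exp t - 1 : ℂ) ≠ 0 := by
      have := Real.add_one_lt_exp ht.ne'
      exact_mod_cast (by linarith : Real.exp t - 1 ≠ 0)
    simp only [smul_eq_mul]
    rw [integral_const_mul, integral_complex_ofReal, integral_const_mul,
      integral_sin_mul_boseWeight ht, Complex.cpow_sub (s - 1) 1 htc, Complex.cpow_one, one_mul, Complex.exp_neg]
    push_cast
    field_simp
    ring
  have hadd : Integrable (fun t : ℝ => 1 / 2 * ((t : ℂ) ^ (s - 1) * Complex.exp (-(1 * t))) +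
      (t : ℂ) ^ (s - 1 - 1) * Complex.exp (-(1 * t))) (volume.restrict (Set.Ioi 0)) :=
    ((integrableOn_cpow_mul_cexp hs0 hone).const_mul _).add (integrableOn_cpow_mul_cexp hs1 hone)
  rw [integral_add hadd hIt, integral_add
    ((integrableOn_cpow_mul_cexp hs0 hone).const_mul _) (integrableOn_cpow_mul_cexp hs1 hone),
    integral_const_mul, integral_cpow_mul_cexp hs0 hone, integral_cpow_mul_cexp hs1 hone, hswap,
    integral_const_mul, mellin_one_div_exp_sub_one hs, Complex.one_cpow, Complex.one_cpow] at hsplit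
  have hG : Complex.Gamma s = (s - 1) * Complex.Gamma (s - 1) := by
    simpa using Complex.Gamma_add_one (s - 1) hne
  apply mul_left_cancel₀ hΓ
  rw [hsplit, hG]
  field_simp

/-! ### Logarithm and powers on the line Re z = 1 -/

lemma one_add_ofReal_mul_I_mem_slitPlane (x : ℝ) :
    (1 + x * Complex.I : ℂ) ∈ Complex.slitPlane := Or.inl (by simp)

lemma log_one_add_mul_I (x : ℝ) : Complex.log (1 + x * Complex.I) =
    ((Real.log (1 + x ^ 2) / 2 : ℝ) : ℂ) + (Real.arctan x : ℂ) * Complex.I := by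
  have hn : ‖(1 + x * Complex.I : ℂ)‖ = √(1 + x ^ 2) := by
    simpa using Complex.norm_add_mul_I 1 x
  apply Complex.ext
  · rw [Complex.log_re, hn, Real.log_sqrt (by positivity), Complex.add_re, Complex.ofReal_re,
      Complex.mul_I_re, Complex.ofReal_im, neg_zero, add_zero]
  · rw [Complex.log_im, Complex.arg_of_re_nonneg (by simp), hn, Real.arctan_eq_arcsin]
    simp

lemma abs_arctan_le (x : ℝ) : |Real.arctan x| ≤ |x| := by
  have h : ∀ y : ℝ, 0 ≤ y → |Real.arctan y| ≤ |y| := fun y hy => by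
    rw [abs_of_nonneg (Real.arctan_nonneg.2 hy), abs_of_nonneg hy]
    simpa using Real.le_tan (Real.arctan_nonneg.2 hy) (Real.arctan_lt_pi_div_two y)
  rcases le_total 0 x with hx | hx
  · exact h x hx
  · simpa [Real.arctan_neg] using h (-x) (by linarith)

lemma log_one_add_sq_div_two_nonneg (x : ℝ) : 0 ≤ Real.log (1 + x ^ 2) / 2 := by
  have := Real.log_nonneg (x := 1 + x ^ 2) (by nlinarith [sq_nonneg x])
  positivity

lemma log_one_add_sq_div_two_le (x : ℝ) :
    Real.log (1 + x ^ 2) / 2 ≤ Real.log (1 + |x|) := by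
  have h : Real.log (1 + x ^ 2) ≤ Real.log ((1 + |x|) ^ 2) :=
    Real.log_le_log (by positivity) (by nlinarith [abs_nonneg x, sq_abs x])
  rw [Real.log_pow] at h
  push_cast at h
  linarith

lemma norm_log_one_add_mul_I_le (x : ℝ) : ‖Complex.log (1 + x * Complex.I)‖ ≤ 2 * |x| := by
  have h1 := Real.log_le_sub_one_of_pos (x := 1 + |x|) (by positivity)
  have h2 := log_one_add_sq_div_two_le x
  rw [log_one_add_mul_I]
  refine (norm_add_le _ _).trans ?_
  rw [norm_mul, Complex.norm_I, Complex.norm_real, Complex.norm_real, mul_one,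
    Real.norm_of_nonneg (log_one_add_sq_div_two_nonneg x), Real.norm_eq_abs]
  linarith [abs_arctan_le x]

/-- The modulus is exp(-Re s · log|1 + ix| + Im s · arctan x), and |arctan x| ≤ 2. -/
lemma norm_one_add_mul_I_cpow_le {M : ℕ} {s : ℂ} (hs : ‖s‖ ≤ M) (x : ℝ) :
    ‖(1 + x * Complex.I : ℂ) ^ (-s)‖ ≤ Real.exp (2 * M) * (1 + |x|) ^ M := by
  have hne : (1 + x * Complex.I : ℂ) ≠ 0 :=
    Complex.slitPlane_ne_zero (one_add_ofReal_mul_I_mem_slitPlane x)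
  have hre := abs_le.1 ((Complex.abs_re_le_norm s).trans hs)
  have him := (Complex.abs_im_le_norm s).trans hs
  have h1 : -s.re * (Real.log (1 + x ^ 2) / 2) ≤ M * Real.log (1 + |x|) :=
    mul_le_mul (by linarith [hre.1]) (log_one_add_sq_div_two_le x)
      (log_one_add_sq_div_two_nonneg x) (Nat.cast_nonneg M)
  have h2 : s.im * Real.arctan x ≤ M * 2 := by
    refine (le_abs_self _).trans ?_
    rw [abs_mul]
    have : |Real.arctan x| ≤ 2 := abs_le.2
      ⟨by linarith [Real.neg_pi_div_two_lt_arctan x, Real.pi_le_four],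
        by linarith [Real.arctan_lt_pi_div_two x, Real.pi_le_four]⟩
    gcongr
  rw [Complex.cpow_def_of_ne_zero hne, Complex.norm_exp, log_one_add_mul_I,
    ← Real.exp_log (show 0 < (1 + |x|) ^ M by positivity), ← Real.exp_add, Real.log_pow]
  apply Real.exp_le_exp.2
  simp only [Complex.mul_re, Complex.add_re, Complex.ofReal_re, Complex.I_re, mul_zero,
    Complex.ofReal_im, Complex.I_im, mul_one, sub_self, add_zero, Complex.neg_re, Complex.add_im,
    Complex.mul_im, zero_add, mul_neg]
  linarith

/-! ### Differentiation in s and analytic continuation -/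

/-- The derivative of `hermiteKernel` in the complex parameter. -/
noncomputable def hermiteKernelDeriv (s : ℂ) (x : ℝ) : ℂ :=
  Complex.I * ((1 - x * Complex.I) ^ (-s) * Complex.log (1 - x * Complex.I) -
    (1 + x * Complex.I) ^ (-s) * Complex.log (1 + x * Complex.I)) * boseWeight x

@[fun_prop]
lemma measurable_hermiteKernel (s : ℂ) : Measurable (hermiteKernel s) := by
  have h1 : Measurable fun x : ℝ => (1 - x * Complex.I : ℂ) ^ (-s) :=
    Measurable.pow_const (by fun_prop) _
  have h2 : Measurable fun x : ℝ => (1 + x * Complex.I : ℂ) ^ (-s) :=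
    Measurable.pow_const (by fun_prop) _
  unfold hermiteKernel
  fun_prop

@[fun_prop]
lemma measurable_hermiteKernelDeriv (s : ℂ) : Measurable (hermiteKernelDeriv s) := by
  have h1 : Measurable fun x : ℝ => (1 - x * Complex.I : ℂ) ^ (-s) :=
    Measurable.pow_const (by fun_prop) _
  have h2 : Measurable fun x : ℝ => (1 + x * Complex.I : ℂ) ^ (-s) :=
    Measurable.pow_const (by fun_prop) _
  unfold hermiteKernelDeriv
  fun_prop

lemma one_sub_ofReal_mul_I (x : ℝ) :
    (1 - x * Complex.I : ℂ) = 1 + ((-x : ℝ) : ℂ) * Complex.I := by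
  push_cast; ring

lemma hasDerivAt_hermiteKernel (s : ℂ) (x : ℝ) :
    HasDerivAt (fun s => hermiteKernel s x) (hermiteKernelDeriv s x) s := by
  have h : ∀ y : ℝ, HasDerivAt (fun s => (1 + y * Complex.I : ℂ) ^ (-s))
      ((1 + y * Complex.I : ℂ) ^ (-s) * Complex.log (1 + y * Complex.I) * -1) s := fun y =>
    (hasDerivAt_neg s).const_cpow
      (Or.inl (Complex.slitPlane_ne_zero (one_add_ofReal_mul_I_mem_slitPlane y)))
  have h1 := h (-x)
  rw [← one_sub_ofReal_mul_I] at h1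
  refine (((h1.sub (h x)).const_mul (-Complex.I)).mul_const (boseWeight x : ℂ)).congr_deriv ?_
  rw [hermiteKernelDeriv]
  ring

/-- Each logarithm is O(x), which offsets the pole of the weight; the bound depends on s only
through M, so it can dominate on a ball. -/
lemma norm_hermiteKernelDeriv_le {M : ℕ} {s : ℂ} (hs : ‖s‖ ≤ M) {x : ℝ} (hx : 0 < x) :
    ‖hermiteKernelDeriv s x‖ ≤ 4 * Real.exp (2 * M) * ((1 + x) ^ M * (x * boseWeight x)) := by
  have hw := boseWeight_pos hx
  have h : ∀ y : ℝ, |y| = x →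
      ‖(1 + y * Complex.I : ℂ) ^ (-s) * Complex.log (1 + y * Complex.I)‖ ≤
        Real.exp (2 * M) * (1 + x) ^ M * (2 * x) := fun y hy => by
    rw [norm_mul, ← hy]
    exact mul_le_mul (norm_one_add_mul_I_cpow_le hs y) (norm_log_one_add_mul_I_le y)
      (norm_nonneg _) (by positivity)
  rw [hermiteKernelDeriv, one_sub_ofReal_mul_I, norm_mul, norm_mul, Complex.norm_I, one_mul,
    Complex.norm_of_nonneg hw.le]
  calc _ ≤ (Real.exp (2 * M) * (1 + x) ^ M * (2 * x) +
        Real.exp (2 * M) * (1 + x) ^ M * (2 * x)) * boseWeight x := by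
        gcongr
        exact (norm_sub_le _ _).trans
          (add_le_add (h (-x) (by simp [abs_of_pos hx])) (h x (abs_of_pos hx)))
    _ = _ := by ring

lemma integrableOn_hermiteKernelDeriv (s : ℂ) :
    IntegrableOn (hermiteKernelDeriv s) (Set.Ioi 0) := by
  obtain ⟨M, hM⟩ := exists_nat_ge ‖s‖
  refine Integrable.mono' ((integrableOn_pow_mul_boseWeight M).const_mul
    (4 * Real.exp (2 * M))) (by fun_prop) ?_
  filter_upwards [ae_restrict_mem measurableSet_Ioi] with x hx
  exact norm_hermiteKernelDeriv_le hM hx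

lemma integrableOn_hermiteKernel (s : ℂ) :
    IntegrableOn (hermiteKernel s) (Set.Ioi 0) := by
  obtain ⟨M, hM⟩ := exists_nat_ge ‖s‖
  refine Integrable.mono' (((integrableOn_pow_mul_boseWeight M).const_mul
    (4 * Real.exp (2 * M))).mul_const M) (by fun_prop) ?_
  filter_upwards [ae_restrict_mem measurableSet_Ioi] with x hx
  have hw := boseWeight_pos hx
  -- The kernel vanishes at s = 0, so the mean value inequality transfers the bound on its
  -- derivative to the kernel itself.
  have h := (convex_closedBall (0 : ℂ) M).norm_image_sub_le_of_norm_hasDerivWithin_le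
    (fun w _ => (hasDerivAt_hermiteKernel w x).hasDerivWithinAt)
    (fun w hw => norm_hermiteKernelDeriv_le (mem_closedBall_zero_iff.1 hw) hx)
    (x := 0) (y := s) (by simp) (by simpa using hM)
  have h0 : hermiteKernel 0 x = 0 := by simp [hermiteKernel]
  rw [h0, sub_zero, sub_zero] at h
  refine h.trans ?_
  have : 0 < x := hx
  gcongr

lemma hasDerivAt_integral_hermiteKernel (s : ℂ) :
    HasDerivAt (fun s => ∫ x in Set.Ioi (0 : ℝ), hermiteKernel s x)
      (∫ x in Set.Ioi (0 : ℝ), hermiteKernelDeriv s x) s := by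
  -- The extra 1 makes M bound the norm on the whole unit ball about s.
  obtain ⟨M, hM⟩ := exists_nat_ge (‖s‖ + 1)
  refine (hasDerivAt_integral_of_dominated_loc_of_deriv_le (𝕜 := ℂ)
    (μ := volume.restrict (Set.Ioi 0))
    (bound := fun x => 4 * Real.exp (2 * M) * ((1 + x) ^ M * (x * boseWeight x)))
    (Metric.ball_mem_nhds s one_pos)
    (Filter.Eventually.of_forall fun s => (measurable_hermiteKernel s).aestronglyMeasurable)
    (integrableOn_hermiteKernel s) (measurable_hermiteKernelDeriv s).aestronglyMeasurable ?_
    ((integrableOn_pow_mul_boseWeight M).const_mul _) ?_).2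
  · filter_upwards [ae_restrict_mem measurableSet_Ioi] with x hx w hw
    refine norm_hermiteKernelDeriv_le ?_ hx
    have := norm_le_norm_add_norm_sub' w s
    linarith [mem_ball_iff_norm.1 hw]
  · exact Filter.Eventually.of_forall fun x w _ => hasDerivAt_hermiteKernel w x

/-- Hermite's formula for the Riemann zeta function. -/
theorem riemannZeta_eq_integral {s : ℂ} (hs : s ≠ 1) :
    riemannZeta s = 1 / 2 + 1 / (s - 1) + ∫ x in Set.Ioi (0 : ℝ), hermiteKernel s x := by
  have hf : AnalyticOnNhd ℂ riemannZeta {1}ᶜ := DifferentiableOn.analyticOnNhd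
    (fun w hw => (differentiableAt_riemannZeta hw).differentiableWithinAt) isOpen_compl_singleton
  have hg : AnalyticOnNhd ℂ (fun s => 1 / 2 + 1 / (s - 1) +
      ∫ x in Set.Ioi (0 : ℝ), hermiteKernel s x) {1}ᶜ := by
    refine DifferentiableOn.analyticOnNhd (fun w hw => ?_) isOpen_compl_singleton
    have hw : w - 1 ≠ 0 := sub_ne_zero.2 hw
    have h1 : DifferentiableAt ℂ (fun w : ℂ => 1 / 2 + 1 / (w - 1)) w := by
      fun_prop (disch := assumption)
    exact (h1.add (hasDerivAt_integral_hermiteKernel w).differentiableAt).differentiableWithinAt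
  -- The punctured plane is connected, and both sides agree near 2.
  refine hf.eqOn_of_preconnected_of_eventuallyEq hg
    (isConnected_compl_singleton_of_one_lt_rank (by simp) 1).isPreconnected
    (z₀ := 2) (by simp) ?_ hs
  have hU : {w : ℂ | 1 < w.re} ∈ nhds 2 :=
    (isOpen_lt continuous_const Complex.continuous_re).mem_nhds (by simp)
  filter_upwards [hU] with w hw
  exact riemannZeta_eq_integral_of_one_lt_re hw

lemma deriv_riemannZeta_eq_integral {s : ℂ} (hs : s ≠ 1) :
    deriv riemannZeta s = -1 / (s - 1) ^ 2 + ∫ x in Set.Ioi (0 : ℝ), hermiteKernelDeriv s x := by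
  have hs' : s - 1 ≠ 0 := sub_ne_zero.2 hs
  have h1 : HasDerivAt (fun w : ℂ => 1 / 2 + 1 / (w - 1)) (-1 / (s - 1) ^ 2) s := by
    simpa using! (((hasDerivAt_id s).sub_const 1).inv hs').const_add (1 / 2)
  have h2 := h1.add (hasDerivAt_integral_hermiteKernel s)
  refine (h2.congr_of_eventuallyEq ?_).deriv
  filter_upwards [isOpen_compl_singleton.mem_nhds hs] with w hw
  exact riemannZeta_eq_integral hw

/-! ### Alternating binomial sums -/

lemma sum_neg_one_pow_mul_choose_succ (n : ℕ) :
    ∑ j ∈ Finset.range (n + 1), (-1 : ℚ) ^ j * (n + 1).choose (j + 1) = 1 := by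
  have h := Int.alternating_sum_range_choose_of_ne (n.succ_ne_zero)
  rw [Nat.succ_eq_add_one, Finset.sum_range_succ'] at h
  have h' : ∑ j ∈ Finset.range (n + 1), (-1 : ℤ) ^ j * (n + 1).choose (j + 1) = 1 := by
    have h2 : ∑ j ∈ Finset.range (n + 1), (-1 : ℤ) ^ j * (n + 1).choose (j + 1) =
      -∑ j ∈ Finset.range (n + 1), (-1 : ℤ) ^ (j + 1) * (n + 1).choose (j + 1) := by
      rw [← Finset.sum_neg_distrib]
      exact Finset.sum_congr rfl fun j _ => by ring
    rw [h2]
    simp at h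
    linarith
  exact_mod_cast h'

lemma choose_div_succ (n j : ℕ) :
    (n.choose j : ℚ) / (j + 1) = (n + 1).choose (j + 1) / (n + 1) := by
  have h : ((n : ℚ) + 1) * n.choose j = (n + 1).choose (j + 1) * (j + 1) := by
    exact_mod_cast Nat.add_one_mul_choose_eq n j
  field_simp
  linarith

lemma sum_neg_one_pow_mul_choose_div (n : ℕ) :
    ∑ j ∈ Finset.range (n + 1), (-1 : ℚ) ^ j * (n.choose j / (j + 1)) = 1 / (n + 1) := by
  simp_rw [choose_div_succ, mul_div_assoc', ← Finset.sum_div, sum_neg_one_pow_mul_choose_succ]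

/-- The alternating binomial expression of the harmonic numbers. -/
lemma sum_neg_one_pow_mul_choose_succ_div (n : ℕ) :
    ∑ j ∈ Finset.range n, (-1 : ℚ) ^ j * (n.choose (j + 1) / (j + 1)) = harmonic n := by
  induction n with
  | zero => simp
  | succ n ih =>
    rw [harmonic_succ, ← ih]
    -- By Pascal's rule the increment is the sum equal to 1/(n + 1); the extra last term of the
    -- other sum vanishes, as C(n, n + 1) = 0.
    have h : ∀ j : ℕ, (-1 : ℚ) ^ j * ((n + 1).choose (j + 1) / (j + 1)) =
        (-1) ^ j * (n.choose j / (j + 1)) + (-1) ^ j * (n.choose (j + 1) / (j + 1)) := fun j => by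
      rw [Nat.choose_succ_succ]; push_cast; ring
    simp_rw [h]
    rw [Finset.sum_add_distrib, sum_neg_one_pow_mul_choose_div,
      Finset.sum_range_succ (n := n) (f := fun j => (-1 : ℚ) ^ j * (n.choose (j + 1) / (j + 1)))]
    simp
    ring

lemma sum_neg_one_pow_mul_choose_div_sq (n : ℕ) :
    ∑ j ∈ Finset.range (n + 1), (-1 : ℂ) ^ j * n.choose j * (1 / (j + 1) ^ 2) =
      (harmonic (n + 1) : ℂ) / (n + 1) := by
  rw [← sum_neg_one_pow_mul_choose_succ_div]
  push_cast
  rw [Finset.sum_div]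
  refine Finset.sum_congr rfl fun j _ => ?_
  have h : (n.choose j : ℂ) / (j + 1) = (n + 1).choose (j + 1) / (n + 1) := by
    have := congrArg (Rat.cast : ℚ → ℂ) (choose_div_succ n j)
    push_cast at this
    exact this
  calc _ = (-1 : ℂ) ^ j * ((n.choose j : ℂ) / (j + 1)) / (j + 1) := by field_simp
    _ = _ := by rw [h]; ring

lemma sum_neg_one_pow_mul_choose_mul_pow (n : ℕ) (z : ℂ) :
    ∑ k ∈ Finset.range (n + 1), (-1 : ℂ) ^ k * n.choose k * z ^ k = (1 - z) ^ n := by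
  rw [sub_eq_neg_add, add_pow]
  refine Finset.sum_congr rfl fun k _ => ?_
  rw [neg_pow z]
  ring

/-! ### The binomial combination and its parity -/

lemma sum_choose_mul_hermiteKernelDeriv (n : ℕ) (x : ℝ) :
    ∑ k ∈ Finset.range (n + 1), (-1 : ℂ) ^ k * n.choose k * hermiteKernelDeriv (-(k : ℂ)) x =
      Complex.I * ((x * Complex.I) ^ n * Complex.log (1 - x * Complex.I) -
        (-(x * Complex.I)) ^ n * Complex.log (1 + x * Complex.I)) * boseWeight x := by
  have h1 := sum_neg_one_pow_mul_choose_mul_pow n (1 - x * Complex.I)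
  have h2 := sum_neg_one_pow_mul_choose_mul_pow n (1 + x * Complex.I)
  rw [sub_sub_cancel] at h1
  rw [sub_add_cancel_left] at h2
  rw [← h1, ← h2, Finset.sum_mul, Finset.sum_mul, ← Finset.sum_sub_distrib, Finset.mul_sum,
    Finset.sum_mul]
  refine Finset.sum_congr rfl fun k _ => ?_
  rw [hermiteKernelDeriv, neg_neg, Complex.cpow_natCast, Complex.cpow_natCast]
  ring

/-- The harmonic term exactly cancels the contribution of the pole term 1/(s - 1), so a single
integral remains for both parities. -/
lemma harmonic_add_sum_deriv_riemannZeta (n : ℕ) :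
    (harmonic (n + 1) : ℂ) / (n + 1) + ∑ k ∈ Finset.range (n + 1),
        (-1 : ℂ) ^ k * (n.choose k : ℂ) * deriv riemannZeta (-(k : ℂ)) =
      ∫ x in Set.Ioi (0 : ℝ), Complex.I *
        ((x * Complex.I) ^ n * Complex.log (1 - x * Complex.I) -
          (-(x * Complex.I)) ^ n * Complex.log (1 + x * Complex.I)) * boseWeight x := by
  have hk : ∀ k : ℕ, deriv riemannZeta (-(k : ℂ)) =
      -(1 / (k + 1) ^ 2) + ∫ x in Set.Ioi (0 : ℝ), hermiteKernelDeriv (-(k : ℂ)) x := fun k => by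
    have h0 : (k : ℂ) + 1 ≠ 0 := by exact_mod_cast k.succ_ne_zero
    rw [deriv_riemannZeta_eq_integral (fun h => h0 (by rw [← neg_eq_iff_eq_neg.2 h.symm]; ring)),
      show (-(k : ℂ) - 1) ^ 2 = (k + 1) ^ 2 by ring, neg_div]
  simp_rw [hk, mul_add, Finset.sum_add_distrib, mul_neg, Finset.sum_neg_distrib]
  rw [sum_neg_one_pow_mul_choose_div_sq, add_neg_cancel_left]
  simp_rw [← sum_choose_mul_hermiteKernelDeriv, ← integral_const_mul]
  exact (integral_finsetSum _ fun k _ => (integrableOn_hermiteKernelDeriv _).const_mul _).symm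

lemma integrableOn_pow_mul_mul_boseWeight (n : ℕ) {f : ℝ → ℝ} (hf : Measurable f)
    (hle : ∀ x, 0 < x → |f x| ≤ 2 * x) :
    IntegrableOn (fun x => x ^ n * f x * boseWeight x) (Set.Ioi 0) := by
  refine Integrable.mono' ((integrableOn_pow_mul_boseWeight n).const_mul 2) (by fun_prop) ?_
  filter_upwards [ae_restrict_mem measurableSet_Ioi] with x hx
  have hx : 0 < x := hx
  have hw := boseWeight_pos hx
  rw [norm_mul, norm_mul, Real.norm_of_nonneg hw.le, Real.norm_of_nonneg (by positivity)]
  calc x ^ n * ‖f x‖ * boseWeight x ≤ (1 + x) ^ n * (2 * x) * boseWeight x := by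
        gcongr
        · linarith
        · exact hle x hx
    _ = _ := by ring

theorem mainTheorem8 :
    (∀ n : ℕ,
      IntegrableOn
          (fun x : ℝ => x ^ (2 * n) * Real.arctan x / (Real.exp (2 * Real.pi * x) - 1))
          (Set.Ioi 0) ∧
        ((2 * (-1) ^ n *
            ∫ x in Set.Ioi (0 : ℝ),
              x ^ (2 * n) * Real.arctan x / (Real.exp (2 * Real.pi * x) - 1) : ℝ) : ℂ) =
          (harmonic (2 * n + 1) : ℂ) / (2 * (n : ℂ) + 1) +
            ∑ k ∈ Finset.range (2 * n + 1),
              (-1 : ℂ) ^ k * ((2 * n).choose k : ℂ) * deriv riemannZeta (-(k : ℂ))) ∧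
    (∀ n : ℕ, 1 ≤ n →
      IntegrableOn
          (fun x : ℝ =>
            x ^ (2 * n - 1) * Real.log (1 + x ^ 2) / (Real.exp (2 * Real.pi * x) - 1))
          (Set.Ioi 0) ∧
        (((-1) ^ n *
            ∫ x in Set.Ioi (0 : ℝ),
              x ^ (2 * n - 1) * Real.log (1 + x ^ 2) / (Real.exp (2 * Real.pi * x) - 1) : ℝ) : ℂ) =
          (harmonic (2 * n) : ℂ) / (2 * (n : ℂ)) +
            ∑ k ∈ Finset.range (2 * n),
              (-1 : ℂ) ^ k * ((2 * n - 1).choose k : ℂ) * deriv riemannZeta (-(k : ℂ))) := by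
  have hdiv : ∀ a x : ℝ, a / (Real.exp (2 * Real.pi * x) - 1) = a * boseWeight x :=
    fun a x => div_eq_mul_inv _ _
  have hminus : ∀ x : ℝ, Complex.log (1 - x * Complex.I) =
      ((Real.log (1 + x ^ 2) / 2 : ℝ) : ℂ) - (Real.arctan x : ℂ) * Complex.I := fun x => by
    rw [one_sub_ofReal_mul_I, log_one_add_mul_I, Real.arctan_neg, neg_sq]
    push_cast
    ring
  simp_rw [hdiv]
  refine ⟨fun n => ⟨integrableOn_pow_mul_mul_boseWeight _ Real.measurable_arctan
    fun x hx => ?_, ?_⟩, fun n hn => ⟨integrableOn_pow_mul_mul_boseWeight _ (by fun_prop)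
    fun x hx => ?_, ?_⟩⟩
  · have := abs_arctan_le x
    rw [abs_of_pos hx] at this
    linarith
  · have h := harmonic_add_sum_deriv_riemannZeta (2 * n)
    push_cast at h
    rw [h, ← integral_const_mul, ← integral_complex_ofReal]
    refine integral_congr_ae (Filter.Eventually.of_forall fun x => ?_)
    simp only []
    rw [hminus, log_one_add_mul_I, (even_two_mul n).neg_pow, mul_pow, pow_mul Complex.I,
      Complex.I_sq]
    push_cast
    -- For an even exponent the half-logarithms cancel and i · (-2i arctan x) = 2 arctan x.
    linear_combination (2 * (-1 : ℂ) ^ n * x ^ (2 * n) * Complex.arctan x * boseWeight x) *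
      Complex.I_sq
  · have h1 := log_one_add_sq_div_two_le x
    have h2 := Real.log_le_sub_one_of_pos (x := 1 + |x|) (by positivity)
    rw [abs_of_pos hx] at h1 h2
    rw [abs_of_nonneg (by linarith [log_one_add_sq_div_two_nonneg x])]
    linarith
  · obtain ⟨m, rfl⟩ : ∃ m, n = m + 1 := ⟨n - 1, by omega⟩
    have h := harmonic_add_sum_deriv_riemannZeta (2 * m + 1)
    rw [show 2 * m + 1 + 1 = 2 * (m + 1) by ring] at h
    rw [show 2 * (m + 1) - 1 = 2 * m + 1 by omega]
    have hc : ((2 * m + 1 : ℕ) : ℂ) + 1 = 2 * ((m + 1 : ℕ) : ℂ) := by push_cast; ring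
    rw [← hc, h, ← integral_const_mul, ← integral_complex_ofReal]
    refine integral_congr_ae (Filter.Eventually.of_forall fun x => ?_)
    simp only []
    rw [hminus, log_one_add_mul_I, (odd_two_mul_add_one m).neg_pow, mul_pow, pow_succ Complex.I,
      pow_mul Complex.I, Complex.I_sq]
    push_cast
    -- For an odd exponent the arctangents cancel, the half-logarithms add up, and i · i^(2m + 1) =
    -- (-1)^(m + 1) gives the sign.
    linear_combination (-(-1 : ℂ) ^ m * x ^ (2 * m + 1) * (Real.log (1 + x ^ 2) : ℝ) *
      boseWeight x) * Complex.I_sq
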